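/- Let $R$ be an associative ring with identity; modules are left $R$-modules. **Terminology.** A module is *indecomposable* if it is nonzero and not the direct sum of two nonzero submodules. A family $(M_i)_{i\in I}$ of $R$-modules is *right T-nilpotent* if for every sequence $(i_n)_{n\ge 1}$ in $I$, every sequence of non-isomorphisms $f_n\in\operatorname{Hom}_R(M_{i_n},M_{i_{n+1}})$ and every finitely generated submodule $X\subseteq M_{i_1}$ there is an $n_0$ with $f_{n_0}f_{n_0-1}\cdots f_1(X)=0$; it is *right semi-T-nilpotent* if this holds for all sequences $(i_n)$ of pairwise distinct indices. A module over a ring $S$ is *semi-artinian* if each of its factor modules has essential socle. An $R$-module $M$ is *algebraically compact* if every system of linear equations $\sum_{j} a_{kj}X_j=m_k$ ($k\in K$, $j\in J$; $(a_{kj})$ a row-finite matrix over $R$, $m_k\in M$, $K$ and $J$ arbitrary sets) that is finitely solvable in $M$ is solvable in $M$; it is *$\Sigma$-algebraically compact* if every direct sum of copies of $M$ is algebraically compact. A *matrix functor* is given by a row-finite matrix $A=(a_{kj})_{k\in K,\,j\in J}$ over $R$ ($K$, $J$ arbitrary sets) and a column index $\alpha\in J$; it assigns to each $R$-module $N$ the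 subgroup $[A,\alpha]N$ of $N$ consisting of all $m_\alpha$, where $(m_j)_{j\in J}\in N^J$ runs through the solutions of $\sum_{j}a_{kj}X_j=0$ ($k\in K$). A *descending chain* of matrix functors is a sequence $P_1,P_2,\dots$ with $P_{n+1}N\subseteq P_nN$ for all $n$ and all $R$-modules $N$; it *becomes uniformly stationary on almost all of the $M_i$* if there are a finite subset $I_0\subseteq I$ and an $n_0$ such that $P_nM_i=P_{n_0}M_i$ for all $n\ge n_0$ and all $i\in I\setminus I_0$. **Proposition.** Let $(M_i)_{i\in I}$ be a family of indecomposable $R$-modules, and set $M=\bigoplus_{i\in I}M_i$ and $S=\operatorname{End}_R(M)$. (1) If $(M_i)$ is right T-nilpotent, then all rings $\operatorname{End}_R(M_i)$ are local. (2) If all rings $\operatorname{End}_R(M_i)$ are local, the following conditions are equivalent: (a) the family $(M_i)$ is right T-nilpotent; (b) the $S$-module $M$ is semi-artinian; (c) $M$ satisfies the descending chain condition for cyclic $S$-submodules; (c$'$) $M$ satisfies the descending chain condition for finitely generated $S$-submodules. As a consequence, every $\Sigma$-algebraically compact $R$-module is the direct sum of a right T-nilpotent family of indecomposable modules. (3)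 If all rings $\operatorname{End}_R(M_i)$ are local, and every descending chain of matrix functors becomes uniformly stationary on almost all of the $M_i$, then the family $(M_i)$ is right semi-T-nilpotent. -/

import Mathlib

open scoped DirectSum

universe u v w

namespace EndoStructure

section Modules

variable (R : Type u) [Ring R] (X : Type v) [AddCommGroup X] [Module R X]

/-- A module is indecomposable if it is nonzero and is not the internal direct sum of two
nonzero submodules. -/
def IsIndecomposable : Prop :=
  Nontrivial X ∧ ∀ A B : Submodule R X, IsCompl A B → A = ⊥ ∨ B = ⊥

/-- The socle of a module: the sum of its simple submodules. -/
def socle : Submodule R X :=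
  sSup {A : Submodule R X | IsSimpleModule R A}

variable {R X} in
/-- A submodule is essential if it meets every nonzero submodule nontrivially. -/
def IsEssential (A : Submodule R X) : Prop :=
  ∀ B : Submodule R X, A ⊓ B = ⊥ → B = ⊥

/-- A module is semi-artinian if each of its factor modules has essential socle. -/
def IsSemiArtinian : Prop :=
  ∀ U : Submodule R X, IsEssential (socle R (X ⧸ U))

/-- The descending chain condition for the submodules that satisfy `P`. -/
def HasDCC (P : Submodule R X → Prop) : Prop :=
  ∀ U : ℕ → Submodule R X, (∀ n, P (U n)) → (∀ n, U (n + 1) ≤ U n) →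
    ∃ N, ∀ n, N ≤ n → U n = U N

variable {R X} in
/-- Cyclic submodules: those that are generated by one element. -/
def IsCyclicSubmodule (A : Submodule R X) : Prop :=
  ∃ x : X, A = Submodule.span R {x}

/-- A module `X` is algebraically compact if every system of linear equations
`∑ j, a i j • Y j = m i` (any number of equations and of unknowns, each equation with finitely
many nonzero coefficients) which is finitely solvable in `X` is solvable in `X`. -/
def IsAlgebraicallyCompact : Prop :=
  ∀ (I J : Type (max u v)) (a : I → J →₀ R) (m : I → X),
    (∀ F : Finset I, ∃ y : J → X, ∀ i ∈ F, ((a i).sum fun j r => r • y j) = m i) →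
      ∃ y : J → X, ∀ i, ((a i).sum fun j r => r • y j) = m i

/-- A module is Σ-algebraically compact if all direct sums of copies of it are algebraically
compact. -/
def IsSigmaAlgebraicallyCompact : Prop :=
  ∀ K : Type (max u v), IsAlgebraicallyCompact R (⨁ _ : K, X)

end Modules

section Nilpotence

variable {R : Type u} [Ring R] {ι : Type w} (M : ι → Type v)
  [∀ i, AddCommGroup (M i)] [∀ i, Module R (M i)]

variable {M} in
/-- The composition `f n ∘ ⋯ ∘ f 0` of consecutive homomorphisms. -/
def compUpTo {i : ℕ → ι} (f : ∀ n, M (i n) →ₗ[R] M (i (n + 1))) :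
    ∀ n, M (i 0) →ₗ[R] M (i (n + 1))
  | 0 => f 0
  | n + 1 => f (n + 1) ∘ₗ compUpTo f n

variable (R) in
/-- The vanishing property required in both right nilpotence conditions, for one sequence of
indices: whatever the non-isomorphisms `f n : M (i n) → M (i (n + 1))` are, each finitely
generated submodule of `M (i 0)` is annihilated by some composition `f n ∘ ⋯ ∘ f 0`. -/
def NilpotentAlong (i : ℕ → ι) : Prop :=
  ∀ f : ∀ n, M (i n) →ₗ[R] M (i (n + 1)), (∀ n, ¬ Function.Bijective (f n)) →
    ∀ A : Submodule R (M (i 0)), A.FG → ∃ n, A.map (compUpTo f n) = ⊥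

variable (R) in
/-- Right T-nilpotence of a family of modules: repetitions of indices are allowed. -/
def IsRightTNilpotent : Prop :=
  ∀ i : ℕ → ι, NilpotentAlong R M i

variable (R) in
/-- Right semi-T-nilpotence of a family of modules: only sequences of distinct indices. -/
def IsRightSemiTNilpotent : Prop :=
  ∀ i : ℕ → ι, Function.Injective i → NilpotentAlong R M i

end Nilpotence

/-- A pointed matrix over `R`: a row-finite matrix together with a column index. -/
structure PointedMatrix (R : Type u) [Ring R] where
  /-- the row indices -/
  Row : Type w
  /-- the column indices -/
  Col : Type w
  /-- the rows, each with finitely many nonzero entries -/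
  entry : Row → Col →₀ R
  /-- the distinguished column -/
  pt : Col

namespace PointedMatrix

variable {R : Type u} [Ring R]

/-- The value at a module `X` of the matrix functor of a pointed matrix: the projection to the
distinguished coordinate of the solution set in `X` of the homogeneous system. -/
def subgroup (P : PointedMatrix.{u, w} R) (X : Type v) [AddCommGroup X] [Module R X] :
    AddSubgroup X where
  carrier := {x | ∃ y : P.Col → X,
    (∀ i, ((P.entry i).sum fun j r => r • y j) = 0) ∧ y P.pt = x}
  zero_mem' := ⟨0, fun i => by simp, rfl⟩
  add_mem' := by
    rintro _ _ ⟨y, hy, rfl⟩ ⟨z, hz, rfl⟩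
    refine ⟨y + z, fun i => ?_, rfl⟩
    simp only [Pi.add_apply, smul_add, Finsupp.sum_add, hy, hz, add_zero]
  neg_mem' := by
    rintro _ ⟨y, hy, rfl⟩
    refine ⟨-y, fun i => ?_, rfl⟩
    simp only [Pi.neg_apply, smul_neg, Finsupp.sum_neg, hy, neg_zero]

/-- A descending chain of matrix functors on the category of all left `R`-modules. -/
def IsDescendingChain (P : ℕ → PointedMatrix.{u, max u v} R) : Prop :=
  ∀ (n : ℕ) (X : Type (max u v)) [AddCommGroup X] [Module R X],
    (P (n + 1)).subgroup X ≤ (P n).subgroup X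

/-- The chain becomes uniformly stationary on almost all members of the family: up to finitely
many exceptional indices, it is stationary on the `M i` from one common place on. -/
def UniformlyStationaryOnAlmostAll (P : ℕ → PointedMatrix.{u, max u v} R) {ι : Type w}
    (M : ι → Type v) [∀ i, AddCommGroup (M i)] [∀ i, Module R (M i)] : Prop :=
  ∃ (E : Finset ι) (N : ℕ), ∀ n, N ≤ n → ∀ i, i ∉ E →
    (P n).subgroup (M i) = (P N).subgroup (M i)

end PointedMatrix

end EndoStructure

namespace EndoStructure

/-! Write `S` for the endomorphism ring of the direct sum. Whether one element of a summand is an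
`S`-multiple of another is decided by homomorphisms between the two summands. Hence a strictly
descending chain of submodules generated by such elements is an orbit under non-isomorphisms that
never reaches zero, which T-nilpotence forbids. A Björk-type argument, `hasDCC_fg_of_homogeneous`,
extends the chain condition to finitely generated submodules, and minimal cyclic submodules then
supply essential socles. Conversely, divide by a submodule maximal among those avoiding a
nonvanishing orbit: a simple submodule of the quotient makes one orbit element a multiple of its
successor, and invertibility of `1 - g` for a non-unit `g` of a local ring forces that element into
the avoided submodule. The same invertibility proves (3), applied to the functors sending `Y` to the
set of all `g x` with `g : X → Y`.

For Σ-algebraically compact modules everything passes through `HomValuesDCC`. It follows by a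
diagonal argument in a countable direct sum of copies, is inherited by direct summands, and makes
finitely solvable systems of conditions on homomorphisms solvable. Solvability makes unions of
chains of summands into summands, so Zorn's lemma gives a decomposition into indecomposables; it
also makes their endomorphism rings local. Since `HomValuesDCC` contains the chain condition for
cyclic `S`-submodules, the equivalence in (2) yields T-nilpotence. -/

/-- The principle of dependent choice. -/
theorem exists_seq_of_step {α : Type*} {r : α → α → Prop} (h : ∀ x, ∃ y, r x y) (x₀ : α) :
    ∃ f : ℕ → α, f 0 = x₀ ∧ ∀ n, r (f n) (f (n + 1)) := by
  choose next hnext using h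
  exact ⟨fun n => Nat.rec x₀ (fun _ => next) n, rfl, fun n => hnext _⟩

/-! ### Chain conditions for cyclic and finitely generated submodules -/

section ChainConditions

variable {S : Type*} [Ring S] {M : Type*} [AddCommGroup M] [Module S M]

open Submodule

/-- Under the descending chain condition for cyclic submodules, every satisfiable property has
a witness generating a cyclic submodule which is minimal among those of witnesses below it. -/
theorem HasDCC.exists_minimal (h : HasDCC S M IsCyclicSubmodule) (p : M → Prop)
    (hp : ∃ x, p x) : ∃ x, p x ∧ ∀ s : S, p (s • x) → x ∈ span S {s • x} := by
  by_contra! hcon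
  obtain ⟨x₀, hx₀⟩ := hp
  obtain ⟨x, -, hx⟩ := exists_seq_of_step (α := Subtype p)
    (r := fun x y => (y : M) ∈ span S {(x : M)} ∧ (x : M) ∉ span S {(y : M)})
    (fun x => by
      obtain ⟨s, hs, hs'⟩ := hcon x x.2
      exact ⟨⟨_, hs⟩, mem_span_singleton.2 ⟨s, rfl⟩, hs'⟩) ⟨x₀, hx₀⟩
  obtain ⟨N, hN⟩ := h (fun n => span S {(x n : M)}) (fun n => ⟨_, rfl⟩) fun n =>
    (span_singleton_le_iff_mem _ _).2 (hx n).1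
  refine (hx N).2 ?_
  have := hN (N + 1) N.le_succ
  exact this ▸ mem_span_singleton_self (x N : M)

/-- Minimality is taken among elements of `M` whose classes are nonzero and lie in `B`, so the chain
condition is never needed in the quotient itself. The class of a minimal such element generates a
simple submodule. -/
theorem isSemiArtinian_of_hasDCC_cyclic (h : HasDCC S M IsCyclicSubmodule) :
    IsSemiArtinian S M := by
  intro U B hB
  by_contra hne
  obtain ⟨b, hb, hb0⟩ := B.ne_bot_iff.1 hne
  obtain ⟨x₀, rfl⟩ := U.mkQ_surjective b
  obtain ⟨x, ⟨hxB, hx0⟩, hx⟩ := h.exists_minimal (fun x => U.mkQ x ∈ B ∧ U.mkQ x ≠ 0)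
    ⟨x₀, hb, hb0⟩
  have hle : span S {U.mkQ x} ≤ B := (span_singleton_le_iff_mem _ _).2 hxB
  have hsimple : IsSimpleModule S (span S {U.mkQ x}) := by
    rw [isSimpleModule_iff_isAtom]
    refine ⟨by simpa using hx0, fun C hC => ?_⟩
    by_contra hC0
    obtain ⟨c, hc, hc0⟩ := C.ne_bot_iff.1 hC0
    obtain ⟨s, rfl⟩ := mem_span_singleton.1 (hC.le hc)
    obtain ⟨t, ht⟩ := mem_span_singleton.1 (hx s ⟨by
      rw [map_smul]; exact B.smul_mem _ hxB, by rwa [map_smul]⟩)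
    refine hC.not_ge ((span_singleton_le_iff_mem _ _).2 ?_)
    rw [← ht, map_smul, map_smul]
    exact C.smul_mem _ hc
  have hsoc : U.mkQ x ∈ socle S (M ⧸ U) ⊓ B :=
    ⟨(le_sSup (a := span S {U.mkQ x}) hsimple) (mem_span_singleton_self _), hxB⟩
  rw [hB] at hsoc
  exact hx0 (by simpa using hsoc)

theorem exists_fg_le_of_le_sup {V P B : Submodule S M} (hV : V.FG) (h : V ≤ P ⊔ B) :
    ∃ B' ≤ B, B'.FG ∧ V ≤ P ⊔ B' := by
  induction V, hV using fg_induction with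
  | singleton x =>
    obtain ⟨p, hp, b, hb, hpb⟩ := mem_sup.1 (h (mem_span_singleton_self x))
    refine ⟨span S {b}, (span_singleton_le_iff_mem _ _).2 hb, fg_span_singleton b, ?_⟩
    rw [span_singleton_le_iff_mem]
    exact mem_sup.2 ⟨p, hp, b, mem_span_singleton_self b, hpb⟩
  | sup V₁ V₂ _ _ h₁ h₂ =>
    obtain ⟨B₁, hB₁, hf₁, hV₁⟩ := h₁ (le_sup_left.trans h)
    obtain ⟨B₂, hB₂, hf₂, hV₂⟩ := h₂ (le_sup_right.trans h)
    exact ⟨B₁ ⊔ B₂, sup_le hB₁ hB₂, hf₁.sup hf₂,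
      sup_le (hV₁.trans (sup_le_sup_left le_sup_left _))
        (hV₂.trans (sup_le_sup_left le_sup_right _))⟩

theorem exists_fg_sup_eq {V P B : Submodule S M} (hV : V.FG) (hP : P ≤ V) (h : V ≤ P ⊔ B) :
    ∃ A ≤ B, A.FG ∧ V = P ⊔ A := by
  have hle : V ≤ P ⊔ B ⊓ V := by
    rw [← sup_inf_assoc_of_le B hP]
    exact le_inf h le_rfl
  obtain ⟨A, hA, hfg, hVA⟩ := exists_fg_le_of_le_sup hV hle
  exact ⟨A, hA.trans inf_le_left, hfg, le_antisymm hVA (sup_le hP (hA.trans inf_le_right))⟩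

variable (S M) in
/-- A submodule all of whose descending chains of finitely generated submodules are
stationary. -/
def FGChainsStationary (U : Submodule S M) : Prop :=
  ∀ V : ℕ → Submodule S M, (∀ n, (V n).FG) → (∀ n, V (n + 1) ≤ V n) → V 0 ≤ U →
    ∃ N, ∀ n, N ≤ n → V n = V N

variable {ι : Type*} {e : ι → S}

/-- The elements lying in one of the Peirce components `e i • M`. -/
def IsHomogeneousAt (e : ι → S) (y : M) : Prop :=
  ∃ i, e i • y = y

theorem exists_homogeneous_notMem (he : ∀ i, e i * e i = e i)
    (hspan : ∀ x : M, x ∈ span S (Set.range fun i => e i • x)) {U V : Submodule S M}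
    (hVU : ¬ V ≤ U) : ∃ y ∈ V, IsHomogeneousAt e y ∧ y ∉ U := by
  obtain ⟨x, hxV, hxU⟩ := SetLike.not_le_iff_exists.1 hVU
  by_contra! hcon
  refine hxU ((span_le.2 ?_) (hspan x))
  rintro _ ⟨i, rfl⟩
  exact hcon _ (V.smul_mem _ hxV) ⟨i, by rw [← mul_smul, he]⟩

/-- `y` is homogeneous, avoids `U`, and each homogeneous multiple of `y` avoiding `U` generates
the same submodule as `y`. -/
def IsMinimalOutside (e : ι → S) (U : Submodule S M) (y : M) : Prop :=
  IsHomogeneousAt e y ∧ y ∉ U ∧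
    ∀ z ∈ span S {y}, IsHomogeneousAt e z → z ∉ U → y ∈ span S {z}

variable (M) in
/-- There is no strictly descending sequence of submodules generated by one homogeneous
element. -/
def HomogeneousDCC (e : ι → S) : Prop :=
  ¬ ∃ y : ℕ → M, (∀ n, IsHomogeneousAt e (y n)) ∧
    ∀ n, y (n + 1) ∈ span S {y n} ∧ y n ∉ span S {y (n + 1)}

theorem exists_isMinimalOutside (hwf : HomogeneousDCC M e)
    (he : ∀ i, e i * e i = e i)
    (hspan : ∀ x : M, x ∈ span S (Set.range fun i => e i • x)) {U V : Submodule S M}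
    (hVU : ¬ V ≤ U) : ∃ y ∈ V, IsMinimalOutside e U y := by
  obtain ⟨x₀, hx₀⟩ := exists_homogeneous_notMem he hspan hVU
  by_contra! hcon
  obtain ⟨y, -, hy⟩ := exists_seq_of_step (α := {y : M // y ∈ V ∧ IsHomogeneousAt e y ∧ y ∉ U})
    (r := fun y z => (z : M) ∈ span S {(y : M)} ∧ (y : M) ∉ span S {(z : M)})
    (fun y => by
      obtain ⟨y, hyV, hy, hyU⟩ := y
      by_contra! hno
      exact hcon y hyV ⟨hy, hyU, fun z hz hz' hzU =>
        hno ⟨z, (span_singleton_le_iff_mem _ _).2 hyV hz, hz', hzU⟩ hz⟩) ⟨x₀, hx₀⟩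
  exact hwf ⟨fun n => y n, fun n => (y n).2.2.1, hy⟩

/-- The generator `y` can be moved into `V` at the cost of an error in `A`: a minimal `v ∈ V` is a
multiple of `y` plus an error, and minimality of `y` allows that multiple to be undone. The result
is a multiple of `v` outside `U`, so it inherits minimality from `v`. -/
theorem IsMinimalOutside.exists_congruent (hwf : HomogeneousDCC M e)
    (he : ∀ i, e i * e i = e i)
    (hspan : ∀ x : M, x ∈ span S (Set.range fun i => e i • x)) {U V A : Submodule S M}
    (hVU : ¬ V ≤ U) {y : M} (hy : IsMinimalOutside e U y) (hA : A ≤ U)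
    (hVy : V ≤ span S {y} ⊔ A) : ∃ y' ∈ V, IsMinimalOutside e U y' ∧ y' - y ∈ A := by
  obtain ⟨v, hvV, ⟨j, hj⟩, hvU, hvmin⟩ := exists_isMinimalOutside hwf he hspan hVU
  obtain ⟨⟨i, hi⟩, hyU, hymin⟩ := hy
  obtain ⟨a, ha, b, hb, hab⟩ := mem_sup.1 (hVy hvV)
  obtain ⟨s, rfl⟩ := mem_span_singleton.1 ha
  have hv : (e j * s) • y + e j • b = v := by rw [mul_smul, ← smul_add, hab, hj]
  have hsU : (e j * s) • y ∉ U := fun h =>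
    hvU (hv ▸ U.add_mem h (U.smul_mem _ (hA hb)))
  obtain ⟨t, ht⟩ := mem_span_singleton.1 (hymin _ (mem_span_singleton.2 ⟨_, rfl⟩)
    ⟨j, by rw [← mul_smul, ← mul_assoc, he]⟩ hsU)
  have hy' : (e i * t) • v - y = (e i * t) • e j • b := by
    rw [← hv, smul_add, mul_smul (e i) t ((e j * s) • y), ht, hi, add_sub_cancel_left]
  have hmem : (e i * t) • v - y ∈ A := hy' ▸ A.smul_mem _ (A.smul_mem _ hb)
  refine ⟨(e i * t) • v, V.smul_mem _ hvV, ⟨⟨i, ?_⟩, fun h => hyU ?_, ?_⟩, hmem⟩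
  · rw [← mul_smul, ← mul_assoc, he]
  · simpa using U.sub_mem h (hA hmem)
  · intro z hz hzh hzU
    have hle : span S {(e i * t) • v} ≤ span S {v} :=
      (span_singleton_le_iff_mem _ _).2 (mem_span_singleton.2 ⟨_, rfl⟩)
    exact smul_mem _ _ (hvmin z (hle hz) hzh hzU)

theorem fgChainsStationary_sup_span (hwf : HomogeneousDCC M e)
    (he : ∀ i, e i * e i = e i)
    (hspan : ∀ x : M, x ∈ span S (Set.range fun i => e i • x)) {U : Submodule S M}
    (hU : FGChainsStationary S M U) {y : M} (hy : IsMinimalOutside e U y) :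
    FGChainsStationary S M (U ⊔ span S {y}) := by
  intro V hfg hdesc hV0
  by_cases hin : ∃ n, V n ≤ U
  · obtain ⟨m, hm⟩ := hin
    obtain ⟨N, hN⟩ := hU (fun n => V (m + n)) (fun n => hfg _) (fun n => hdesc _) hm
    refine ⟨m + N, fun n hn => ?_⟩
    obtain ⟨k, rfl⟩ := Nat.exists_eq_add_of_le (Nat.le_of_add_right_le hn)
    exact hN k (by omega)
  push Not at hin
  -- The chain is written as `V n = S z + A` with `z` and `A` depending on `n`. The `A`'s descend
  -- inside `U`, hence become stationary, and consecutive `z`'s differ by elements of `A`, so `V`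
  -- becomes stationary too.
  let State := M × Submodule S M
  let Inv : ℕ → State → Prop := fun n p =>
    IsMinimalOutside e U p.1 ∧ p.2 ≤ U ∧ V n ≤ span S {p.1} ⊔ p.2
  let Rel : ℕ → State → State → Prop := fun n p q =>
    q.1 - p.1 ∈ p.2 ∧ q.2 ≤ p.2 ∧ q.2.FG ∧ V n = span S {q.1} ⊔ q.2
  have step : ∀ n (p : {p // Inv n p}), ∃ q : {q // Inv (n + 1) q}, Rel n p.1 q.1 := by
    rintro n ⟨⟨z, A⟩, hz, hA, hVz⟩
    obtain ⟨z', hz'V, hz', hzz'⟩ := hz.exists_congruent hwf he hspan (hin n) hA hVz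
    have hle : V n ≤ span S {z'} ⊔ A := by
      refine hVz.trans (sup_le ?_ le_sup_right)
      rw [span_singleton_le_iff_mem]
      exact mem_sup.2 ⟨z', mem_span_singleton_self _, -(z' - z), A.neg_mem hzz', by abel⟩
    obtain ⟨A', hA', hfg', hVA'⟩ := exists_fg_sup_eq (hfg n)
      ((span_singleton_le_iff_mem _ _).2 hz'V) hle
    exact ⟨⟨(z', A'), hz', hA'.trans hA, (hdesc n).trans hVA'.le⟩, hzz', hA', hfg', hVA'⟩
  choose next hnext using step
  let p : ∀ n, {p // Inv n p} := fun n =>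
    Nat.rec ⟨(y, U), hy, le_rfl, hV0.trans (sup_comm _ _).le⟩ (fun n => next n) n
  have hp : ∀ n, Rel n (p n).1 (p (n + 1)).1 := fun n => hnext n (p n)
  obtain ⟨N, hN⟩ := hU (fun n => (p (n + 1)).1.2) (fun n => (hp n).2.2.1)
    (fun n => (hp (n + 1)).2.1) (p 1).2.2.1
  refine ⟨N, fun n hn => ?_⟩
  induction n, hn using Nat.le_induction with
  | base => rfl
  | succ n hn ih =>
    rw [← ih, (hp n).2.2.2, (hp (n + 1)).2.2.2]
    have h₁ : (p (n + 1 + 1)).1.2 = (p (n + 1)).1.2 :=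
      (hN (n + 1) (by omega)).trans (hN n hn).symm
    have h₂ := (hp (n + 1)).1
    rw [h₁]
    refine le_antisymm (sup_le ?_ le_sup_right) (sup_le ?_ le_sup_right) <;>
      rw [span_singleton_le_iff_mem]
    · exact mem_sup.2 ⟨_, mem_span_singleton_self _, _, h₂, by abel⟩
    · exact mem_sup.2 ⟨_, mem_span_singleton_self _, _, neg_mem h₂, by abel⟩

/-- A variant of Björk's theorem: the descending chain condition for the submodules generated
by one homogeneous element implies that for finitely generated submodules. -/
theorem hasDCC_fg_of_homogeneous (hwf : HomogeneousDCC M e)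
    (he : ∀ i, e i * e i = e i)
    (hspan : ∀ x : M, x ∈ span S (Set.range fun i => e i • x)) :
    HasDCC S M Submodule.FG := by
  obtain ⟨U, hU⟩ := zorn_le₀ {U | FGChainsStationary S M U} fun c hc hchain => by
    rcases c.eq_empty_or_nonempty with rfl | hne
    · refine ⟨⊥, fun V _ hd h0 => ⟨0, fun n _ => ?_⟩, by simp⟩
      have : ∀ n, V n ≤ ⊥ := fun n => (antitone_nat_of_succ_le hd n.zero_le).trans h0
      rw [le_bot_iff.1 (this n), le_bot_iff.1 (this 0)]
    -- Finitely generated submodules are compact, so `V 0` already lies in one member of the chain.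
    · refine ⟨sSup c, fun V hf hd h0 => ?_, fun _ => le_sSup⟩
      obtain ⟨W, hW, hle⟩ := (CompleteLattice.isCompactElement_iff_le_of_directed_sSup_le _ _).1
        ((fg_iff_compact _).1 (hf 0)) c hne hchain.directedOn h0
      exact hc hW V hf hd hle
  have htop : U = ⊤ := by
    by_contra hne
    obtain ⟨y, -, hy⟩ := exists_isMinimalOutside hwf he hspan (V := ⊤) (U := U)
      (by simpa using hne)
    have := hU.2 (fgChainsStationary_sup_span hwf he hspan hU.1 hy) le_sup_left
    exact hy.2.1 (this (mem_sup_right (mem_span_singleton_self y)))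
  exact fun V hf hd => hU.1 V hf hd (htop ▸ le_top)

end ChainConditions

/-! ### T-nilpotence in terms of orbits of single elements -/

section Orbits

variable {R : Type u} [Ring R] {ι : Type w} {M : ι → Type v}
  [∀ i, AddCommGroup (M i)] [∀ i, Module R (M i)]

/-- The successive images of an element under a sequence of consecutive homomorphisms. -/
def orbit {i : ℕ → ι} (f : ∀ n, M (i n) →ₗ[R] M (i (n + 1))) (x : M (i 0)) : ∀ n, M (i n)
  | 0 => x
  | n + 1 => f n (orbit f x n)

theorem compUpTo_apply {i : ℕ → ι} (f : ∀ n, M (i n) →ₗ[R] M (i (n + 1))) (x : M (i 0)) (n : ℕ) :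
    compUpTo f n x = orbit f x (n + 1) := by
  induction n with
  | zero => rfl
  | succ n ih => exact congrArg (f (n + 1)) ih

theorem map_compUpTo_eq_bot_of_le {i : ℕ → ι} {f : ∀ n, M (i n) →ₗ[R] M (i (n + 1))}
    {A : Submodule R (M (i 0))} {m n : ℕ} (hmn : m ≤ n) (h : A.map (compUpTo f m) = ⊥) :
    A.map (compUpTo f n) = ⊥ := by
  induction n, hmn using Nat.le_induction with
  | base => exact h
  | succ n _ ih => rw [compUpTo, Submodule.map_comp, ih, Submodule.map_bot]

theorem nilpotentAlong_of_orbit {i : ℕ → ι}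
    (h : ∀ f : ∀ n, M (i n) →ₗ[R] M (i (n + 1)), (∀ n, ¬ Function.Bijective (f n)) →
      ∀ x, ∃ n, orbit f x n = 0) : NilpotentAlong R M i := by
  intro f hf A hA
  induction A, hA using Submodule.fg_induction with
  | singleton x =>
    obtain ⟨n, hn⟩ := h f hf x
    refine ⟨n, ?_⟩
    rw [Submodule.map_span, Set.image_singleton, compUpTo_apply, orbit, hn, map_zero,
      Submodule.span_zero_singleton]
  | sup A B _ _ hA hB =>
    obtain ⟨m, hm⟩ := hA
    obtain ⟨n, hn⟩ := hB
    refine ⟨max m n, ?_⟩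
    rw [Submodule.map_sup, map_compUpTo_eq_bot_of_le (le_max_left m n) hm,
      map_compUpTo_eq_bot_of_le (le_max_right m n) hn, sup_bot_eq]

theorem NilpotentAlong.exists_orbit_eq_zero {i : ℕ → ι} (h : NilpotentAlong R M i)
    {f : ∀ n, M (i n) →ₗ[R] M (i (n + 1))} (hf : ∀ n, ¬ Function.Bijective (f n)) (x : M (i 0)) :
    ∃ n, orbit f x (n + 1) = 0 := by
  obtain ⟨n, hn⟩ := h f hf _ (Submodule.fg_span_singleton x)
  refine ⟨n, ?_⟩
  rw [← compUpTo_apply, ← Submodule.mem_bot R, ← hn]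
  exact Submodule.mem_map_of_mem (Submodule.mem_span_singleton_self x)

end Orbits

/-! ### Indecomposable modules and local endomorphism rings -/

section Indecomposable

variable {R : Type u} [Ring R] {X : Type v} [AddCommGroup X] [Module R X]
  {Y : Type*} [AddCommGroup Y] [Module R Y]

/-- A split monomorphism from a nonzero module to an indecomposable one is an isomorphism. -/
theorem IsIndecomposable.bijective_of_comp [Nontrivial X] (hY : IsIndecomposable R Y)
    {f : X →ₗ[R] Y} {g : Y →ₗ[R] X} (h : Function.Bijective (g ∘ₗ f)) : Function.Bijective f := by
  let a := LinearEquiv.ofBijective (g ∘ₗ f) h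
  have hinv : ∀ x, a.symm (g (f x)) = x := fun x => a.symm_apply_apply x
  have hcompl : IsCompl (LinearMap.range f) (LinearMap.ker g) := by
    constructor
    · rw [Submodule.disjoint_def]
      rintro _ ⟨x, rfl⟩ hx
      rw [← hinv x, LinearMap.mem_ker.1 hx, map_zero, map_zero]
    · rw [codisjoint_iff, eq_top_iff]
      intro y _
      refine Submodule.mem_sup.2 ⟨f (a.symm (g y)), ⟨_, rfl⟩, y - f (a.symm (g y)), ?_, by abel⟩
      rw [LinearMap.mem_ker, map_sub]
      exact sub_eq_zero.2 (a.apply_symm_apply (g y)).symm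
  have hinj : Function.Injective f := fun x y hxy => by rw [← hinv x, hxy, hinv]
  refine ⟨hinj, LinearMap.range_eq_top.1 ?_⟩
  rcases hY.2 _ _ hcompl with h0 | h0
  · obtain ⟨x, hx⟩ := exists_ne (0 : X)
    have : f x ∈ (⊥ : Submodule R Y) := h0 ▸ ⟨x, rfl⟩
    exact absurd (hinj (((Submodule.mem_bot R).1 this).trans f.map_zero.symm)) hx
  · simpa [h0] using hcompl.sup_eq_top

/-- For a non-isomorphism `f` the geometric series inverts `1 - f` pointwise, although `f` need not
be nilpotent. -/
theorem isLocalRing_of_locally_nilpotent [Nontrivial X]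
    (h : ∀ f : Module.End R X, ¬ Function.Bijective f → ∀ x, ∃ n, (f ^ n) x = 0) :
    IsLocalRing (Module.End R X) := by
  refine IsLocalRing.of_isUnit_or_isUnit_one_sub_self fun f => ?_
  simp only [Module.End.isUnit_iff]
  refine or_iff_not_imp_left.2 fun hf => ⟨?_, fun x => ?_⟩
  · rw [injective_iff_map_eq_zero]
    intro x hx
    have hfx : f x = x := (sub_eq_zero.1 hx).symm
    obtain ⟨n, hn⟩ := h f hf x
    rw [← hn, Module.End.pow_apply, Function.iterate_fixed hfx]
  · obtain ⟨n, hn⟩ := h f hf x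
    refine ⟨(∑ k ∈ Finset.range n, f ^ k) x, ?_⟩
    rw [← Module.End.mul_apply, mul_neg_geom_sum, LinearMap.sub_apply, hn, sub_zero]
    rfl

theorem bijective_one_sub_of_isLocalRing [IsLocalRing (Module.End R X)] {f : Module.End R X}
    (hf : ¬ Function.Bijective f) : Function.Bijective (1 - f : Module.End R X) := by
  rw [← Module.End.isUnit_iff] at hf ⊢
  exact (IsLocalRing.isUnit_or_isUnit_of_add_one (add_sub_cancel f 1)).resolve_left hf

theorem eq_zero_of_fixed_of_not_bijective [IsLocalRing (Module.End R X)] {f : Module.End R X}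
    (hf : ¬ Function.Bijective f) {x : X} (hx : f x = x) : x = 0 :=
  (injective_iff_map_eq_zero (1 - f : Module.End R X)).1 (bijective_one_sub_of_isLocalRing hf).1 x
    (by simp [hx])

end Indecomposable

/-! ### The equivalence of T-nilpotence with the conditions over the endomorphism ring -/

section Families

variable {R : Type u} [Ring R] {ι : Type w} {M : ι → Type v}
  [∀ i, AddCommGroup (M i)] [∀ i, Module R (M i)]

theorem IsRightTNilpotent.isLocalRing (h : IsRightTNilpotent R M) (i : ι) [Nontrivial (M i)] :
    IsLocalRing (Module.End R (M i)) := by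
  refine isLocalRing_of_locally_nilpotent fun f hf x => ?_
  obtain ⟨n, hn⟩ := (h fun _ => i).exists_orbit_eq_zero (f := fun _ => f) (fun _ => hf) x
  have : ∀ n, orbit (M := M) (i := fun _ => i) (fun _ => f) x n = (f ^ n) x := by
    intro n
    induction n with
    | zero => rfl
    | succ n ih => rw [pow_succ', Module.End.mul_apply, ← ih]; rfl
  exact ⟨n + 1, (this _).symm.trans hn⟩

open DirectSum Submodule

variable [DecidableEq ι]

/-- The endomorphism of a direct sum that is given by a homomorphism between two summands. -/
def extendEnd {i j : ι} (g : M i →ₗ[R] M j) : Module.End R (⨁ i, M i) :=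
  lof R ι M j ∘ₗ g ∘ₗ component R ι M i

@[simp]
theorem extendEnd_lof {i j : ι} (g : M i →ₗ[R] M j) (x : M i) :
    extendEnd g (lof R ι M i x) = lof R ι M j (g x) := by
  simp [extendEnd, component.lof_self]

theorem lof_component_mem_span (x : ⨁ i, M i) (i : ι) :
    lof R ι M i (component R ι M i x) ∈ span (Module.End R (⨁ i, M i)) {x} :=
  mem_span_singleton.2 ⟨extendEnd (i := i) LinearMap.id, rfl⟩

theorem lof_mem_span_lof_iff {i j : ι} {x : M i} {y : M j} :
    lof R ι M j y ∈ span (Module.End R (⨁ i, M i)) {lof R ι M i x} ↔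
      ∃ g : M i →ₗ[R] M j, g x = y := by
  rw [mem_span_singleton]
  constructor
  · rintro ⟨s, hs⟩
    refine ⟨component R ι M j ∘ₗ s ∘ₗ lof R ι M i, ?_⟩
    have := congrArg (component R ι M j) hs
    rwa [component.lof_self] at this
  · rintro ⟨g, rfl⟩
    exact ⟨extendEnd g, extendEnd_lof g x⟩

theorem isRightTNilpotent_of_isSemiArtinian (hM : ∀ i, IsIndecomposable R (M i))
    (hloc : ∀ i, IsLocalRing (Module.End R (M i)))
    (h : IsSemiArtinian (Module.End R (⨁ i, M i)) (⨁ i, M i)) : IsRightTNilpotent R M := by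
  refine fun i => nilpotentAlong_of_orbit fun f hf x => ?_
  by_contra! hx
  let y : ℕ → ⨁ i, M i := fun n => lof R ι M (i n) (orbit f x n)
  have hy : ∀ n, y n ≠ 0 := fun n h0 => hx n (by
    have := congrArg (component R ι M (i n)) h0
    rwa [component.lof_self, map_zero] at this)
  obtain ⟨U, hU⟩ := zorn_le₀ {U : Submodule (Module.End R (⨁ i, M i)) (⨁ i, M i) |
      ∀ n, y n ∉ U} fun c hc hchain => by
    rcases c.eq_empty_or_nonempty with rfl | hne
    · exact ⟨⊥, fun n => by simpa using hy n, by simp⟩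
    · refine ⟨sSup c, fun n hn => ?_, fun _ => le_sSup⟩
      obtain ⟨V, hV, hnV⟩ := (mem_sSup_of_directed hne hchain.directedOn).1 hn
      exact hc hV n hnV
  have hsoc : socle (Module.End R (⨁ i, M i)) ((⨁ i, M i) ⧸ U) ≠ ⊥ := by
    intro h0
    have htop := h U ⊤ (by rw [h0, bot_inf_eq])
    have : U.mkQ (y 0) ∈ (⊤ : Submodule (Module.End R (⨁ i, M i)) ((⨁ i, M i) ⧸ U)) := trivial
    rw [htop] at this
    exact hU.1 0 (by simpa using this)
  obtain ⟨A, hA, hA0⟩ : ∃ A : Submodule (Module.End R (⨁ i, M i)) ((⨁ i, M i) ⧸ U),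
      IsAtom A ∧ A ≠ ⊥ := by
    by_contra! hno
    refine hsoc (eq_bot_iff.2 (sSup_le fun A hA => ?_))
    rw [hno A (isSimpleModule_iff_isAtom.1 hA)]
  obtain ⟨n, hn⟩ : ∃ n, U.mkQ (y n) ∈ A := by
    by_contra! hno
    have hle : A.comap U.mkQ ≤ U := hU.2 (y := A.comap U.mkQ) hno fun z hz => by
      have : U.mkQ z = 0 := by simpa using hz
      rw [mem_comap, this]
      exact A.zero_mem
    refine hA0 (eq_bot_iff.2 fun a ha => ?_)
    obtain ⟨z, rfl⟩ := U.mkQ_surjective a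
    have : z ∈ U := hle ha
    simpa using this
  have hstep : y (n + 1) = extendEnd (f n) • y n := (extendEnd_lof (f n) (orbit f x n)).symm
  have hspan : span (Module.End R (⨁ i, M i)) {U.mkQ (y (n + 1))} = A := by
    refine (hA.le_iff.1 ?_).resolve_left ?_
    · rw [span_singleton_le_iff_mem, hstep, map_smul]
      exact A.smul_mem _ hn
    · rw [span_singleton_eq_bot]
      intro h0
      exact hU.1 (n + 1) (by simpa using h0)
  rw [← hspan] at hn
  obtain ⟨s, hs⟩ := mem_span_singleton.1 hn
  have hmem : y n - s • y (n + 1) ∈ U := by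
    rw [← U.ker_mkQ, LinearMap.mem_ker, map_sub, map_smul, hs, sub_self]
  -- Modulo `U`, `y n` is the multiple `s • y (n + 1)`, so `1 - g` sends the orbit element to a
  -- component of an element of `U`. Inverting `1 - g` puts `y n` into `U`.
  let g : Module.End R (M (i n)) :=
    (component R ι M (i n) ∘ₗ s ∘ₗ lof R ι M (i (n + 1))) ∘ₗ f n
  have hg : ¬ Function.Bijective g := fun hb =>
    have := (hM (i n)).1
    hf n ((hM (i (n + 1))).bijective_of_comp hb)
  have := hloc (i n)
  let b := LinearEquiv.ofBijective _ (bijective_one_sub_of_isLocalRing hg)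
  have hb : b (orbit f x n) = component R ι M (i n) (y n - s • y (n + 1)) := by
    rw [map_sub, component.lof_self]
    rfl
  refine hU.1 n ?_
  have := U.smul_mem (extendEnd b.symm.toLinearMap)
    ((span_singleton_le_iff_mem _ _).2 hmem (lof_component_mem_span _ (i n)))
  rw [← hb] at this
  change extendEnd _ (lof R ι M (i n) _) ∈ U at this
  rw [extendEnd_lof] at this
  change lof R ι M (i n) (b.symm (b _)) ∈ U at this
  rwa [b.symm_apply_apply] at this

theorem IsRightTNilpotent.hasDCC_fg (h : IsRightTNilpotent R M) :
    HasDCC (Module.End R (⨁ i, M i)) (⨁ i, M i) Submodule.FG := by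
  refine hasDCC_fg_of_homogeneous
    (e := fun i => extendEnd (M := M) (i := i) (LinearMap.id : M i →ₗ[R] M i)) ?_ (fun i => ?_)
    fun x => ?_
  · rintro ⟨y, hy, hstep⟩
    choose i hi using hy
    let z : ∀ n, M (i n) := fun n => component R ι M (i n) (y n)
    have hyz : ∀ n, y n = lof R ι M (i n) (z n) := fun n => (hi n).symm
    simp only [hyz, lof_mem_span_lof_iff, not_exists] at hstep
    choose f hf using fun n => (hstep n).1
    have hf' := fun n => (hstep n).2
    have hnb : ∀ n, ¬ Function.Bijective (f n) := fun n hb =>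
      hf' n (LinearEquiv.ofBijective (f n) hb).symm.toLinearMap (by
        rw [← hf n]; exact (LinearEquiv.ofBijective (f n) hb).symm_apply_apply _)
    obtain ⟨n, hn⟩ := (h i).exists_orbit_eq_zero hnb (z 0)
    have horb : ∀ n, orbit f (z 0) n = z n := by
      intro n
      induction n with
      | zero => rfl
      | succ n ih => rw [orbit, ih, hf]
    rw [horb] at hn
    -- A zero term is the image of the next term under the zero map, contrary to strict descent.
    exact hf' (n + 1) 0 ((LinearMap.zero_apply _).trans hn.symm)
  · ext j x : 2
    simp [extendEnd, Module.End.mul_apply, component.lof_self]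
  · classical
    have hmem : ∑ i ∈ DFinsupp.support x, of M i (x i) ∈ span (Module.End R (⨁ i, M i))
        (Set.range fun i => extendEnd (M := M) (LinearMap.id : M i →ₗ[R] M i) • x) :=
      sum_mem fun i _ => subset_span ⟨i, rfl⟩
    rwa [DirectSum.sum_support_of] at hmem

end Families

/-! ### Matrix functors and semi-T-nilpotence -/

section MatrixFunctors

variable {R : Type u} [Ring R]

theorem exists_comp_eq_of_ker_le {F Q Y : Type*} [AddCommGroup F] [Module R F] [AddCommGroup Q]
    [Module R Q] [AddCommGroup Y] [Module R Y] {p : F →ₗ[R] Q} (hp : Function.Surjective p)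
    {f : F →ₗ[R] Y} (h : LinearMap.ker p ≤ LinearMap.ker f) : ∃ g : Q →ₗ[R] Y, ∀ a, g (p a) = f a :=
  ⟨(LinearMap.ker p).liftQ f h ∘ₗ (p.quotKerEquivOfSurjective hp).symm.toLinearMap, fun a => by
    have : (p.quotKerEquivOfSurjective hp).symm (p a) = (LinearMap.ker p).mkQ a :=
      (LinearEquiv.symm_apply_eq _).2 rfl
    simp [this]⟩

/-- The pointed matrix of all linear relations between the elements of a module. -/
def relationMatrix {X : Type v} [AddCommGroup X] [Module R X] (x : X) :
    PointedMatrix.{u, max u v} R where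
  Row := ULift.{max u v} {a : ULift.{max u v} X →₀ R // (a.sum fun j r => r • j.down) = 0}
  Col := ULift.{max u v} X
  entry i := i.down.1
  pt := ⟨x⟩

/-- A solution of all linear relations of `X` is the same thing as a homomorphism out of `X`. -/
theorem mem_subgroup_relationMatrix {X : Type v} [AddCommGroup X] [Module R X] {x : X}
    {Y : Type*} [AddCommGroup Y] [Module R Y] {y : Y} :
    y ∈ (relationMatrix (R := R) x).subgroup Y ↔ ∃ g : X →ₗ[R] Y, g x = y := by
  constructor
  · rintro ⟨z, hz, rfl⟩
    obtain ⟨z', hz'⟩ : ∃ z' : ULift.{max u v} X → Y, z' = z := ⟨z, rfl⟩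
    have hsurj : Function.Surjective
        (Finsupp.linearCombination R fun j : ULift.{max u v} X => j.down) := fun x =>
      ⟨Finsupp.single ⟨x⟩ 1, by simp⟩
    obtain ⟨g, hg⟩ := exists_comp_eq_of_ker_le hsurj
      (f := Finsupp.linearCombination R z') fun a ha => by
        rw [hz']
        exact hz ⟨⟨a, ha⟩⟩
    refine ⟨g, ?_⟩
    have := hg (Finsupp.single ⟨x⟩ 1)
    rwa [Finsupp.linearCombination_single, Finsupp.linearCombination_single, one_smul,
      one_smul, hz'] at this
  · rintro ⟨g, rfl⟩
    refine ⟨fun j => g j.down, fun i => ?_, rfl⟩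
    have := congrArg g i.down.2
    rw [map_finsuppSum, map_zero] at this
    simp only [map_smul] at this
    exact this

theorem isRightSemiTNilpotent_of_uniformlyStationary {ι : Type w} {M : ι → Type v}
    [∀ i, AddCommGroup (M i)] [∀ i, Module R (M i)] (hM : ∀ i, IsIndecomposable R (M i))
    (hloc : ∀ i, IsLocalRing (Module.End R (M i)))
    (h : ∀ P : ℕ → PointedMatrix.{u, max u v} R, PointedMatrix.IsDescendingChain.{u, v} P →
      PointedMatrix.UniformlyStationaryOnAlmostAll.{u, v, w} P M) :
    IsRightSemiTNilpotent R M := by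
  refine fun i hi => nilpotentAlong_of_orbit fun f hf x => ?_
  obtain ⟨E, N, hN⟩ := h (fun n => relationMatrix (orbit f x n)) fun n X _ _ y hy => by
    obtain ⟨g, hg⟩ := mem_subgroup_relationMatrix.1 hy
    exact mem_subgroup_relationMatrix.2 ⟨g ∘ₗ f n, hg⟩
  -- Distinctness of the indices is needed here. At such an `n`, stationarity on `M (i n)` gives a
  -- map `g` with `g ∘ f n` fixing the `n`-th orbit element, which therefore vanishes.
  obtain ⟨n, hnN, hnE⟩ : ∃ n, N ≤ n ∧ i n ∉ E := by
    by_contra! hcon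
    exact Set.infinite_of_injective_forall_mem (f := fun n => i (N + n))
      (fun a b hab => Nat.add_left_cancel (hi hab)) (fun n => hcon _ (Nat.le_add_right _ _))
      E.finite_toSet
  have heq := (hN (n + 1) (by omega) (i n) hnE).trans (hN n hnN (i n) hnE).symm
  have hmem : orbit f x n ∈ (relationMatrix (R := R) (orbit f x n)).subgroup (M (i n)) :=
    mem_subgroup_relationMatrix.2 ⟨LinearMap.id, rfl⟩
  rw [← heq] at hmem
  obtain ⟨g, hg⟩ := mem_subgroup_relationMatrix.1 hmem
  have := hloc (i n)
  have := (hM (i n)).1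
  exact ⟨n, eq_zero_of_fixed_of_not_bijective (f := g ∘ₗ f n)
    (fun hb => hf n ((hM (i (n + 1))).bijective_of_comp hb)) hg⟩

end MatrixFunctors

/-! ### From Σ-algebraic compactness to the chain condition on values of homomorphisms -/

section Systems

variable {R : Type u} [Ring R]

/-- In an algebraically compact module, a directed union of solvable systems of conditions
`φ q = x` on a homomorphism `φ` is solvable. -/
theorem IsAlgebraicallyCompact.exists_hom {X : Type v} [AddCommGroup X] [Module R X]
    (hX : IsAlgebraicallyCompact R X) {Q : Type (max u v)} [AddCommGroup Q] [Module R Q]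
    {Λ : Type*} [Nonempty Λ] (E : Λ → Set (Q × X)) (hE : Directed (· ⊆ ·) E)
    (h : ∀ l, ∃ φ : Q →ₗ[R] X, ∀ p ∈ E l, φ p.1 = p.2) :
    ∃ φ : Q →ₗ[R] X, ∀ l, ∀ p ∈ E l, φ p.1 = p.2 := by
  let π := Finsupp.linearCombination R (id : Q → Q)
  -- The unknowns are the values of `φ` on all elements of `Q`. The second kind of equation, the
  -- relations of `Q`, makes a solution linear.
  let I := {p : (Q →₀ R) × X // p ∈ (⋃ l, {p | (π p.1, p.2) ∈ E l}) ∨ (π p.1 = 0 ∧ p.2 = 0)}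
  have hsum : ∀ (y : Q → X) (a : Q →₀ R),
      (a.sum fun j r => r • y j) = Finsupp.linearCombination R y a := fun _ _ => rfl
  have hπ : Function.Surjective π := fun q => ⟨Finsupp.single q 1, by simp [π]⟩
  obtain ⟨y, hy⟩ := hX I Q (fun p => p.1.1) (fun p => p.1.2) fun F => by
    classical
    obtain ⟨l, hl⟩ := hE.exists_mem_subset_of_finset_subset_biUnion
      (s := (F.image fun p : I => (π p.1.1, p.1.2)).filter (· ∈ ⋃ l, E l)) (by
        intro p hp
        exact (Finset.mem_filter.1 hp).2)
    obtain ⟨φ, hφ⟩ := h l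
    refine ⟨φ, fun p hp => ?_⟩
    have : Finsupp.linearCombination R φ p.1.1 = φ (π p.1.1) := by
      simp [π, Finsupp.linearCombination_apply, map_finsuppSum]
    rw [hsum, this]
    rcases p.2 with h | ⟨h, h'⟩
    · refine hφ _ (hl (a := (π p.1.1, p.1.2)) ?_)
      rw [Finset.mem_coe, Finset.mem_filter]
      refine ⟨Finset.mem_image_of_mem _ hp, ?_⟩
      simpa using h
    · rw [h, h', map_zero]
  obtain ⟨φ, hφ⟩ := exists_comp_eq_of_ker_le hπ (f := Finsupp.linearCombination R y)
    fun a ha => hy ⟨(a, 0), Or.inr ⟨ha, rfl⟩⟩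
  refine ⟨φ, fun l p hp => ?_⟩
  obtain ⟨a, ha⟩ := hπ p.1
  rw [← ha, hφ]
  exact hy ⟨(a, p.2), Or.inl (Set.mem_iUnion.2 ⟨l, by
    rw [Set.mem_ofPred_eq, ha]; exact hp⟩)⟩

/-- The subgroup of the values at `a` of all homomorphisms `N → X`. -/
def homValues {N : Type*} [AddCommGroup N] [Module R N] (a : N) (X : Type*) [AddCommGroup X]
    [Module R X] : AddSubgroup X :=
  (LinearMap.evalAddMonoidHom (σ₁₂ := RingHom.id R) (M₂ := X) a).range

theorem mem_homValues {N : Type*} [AddCommGroup N] [Module R N] {a : N} {X : Type*}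
    [AddCommGroup X] [Module R X] {x : X} :
    x ∈ homValues (R := R) a X ↔ ∃ φ : N →ₗ[R] X, φ a = x := Iff.rfl

theorem homValues_le {N N' : Type*} [AddCommGroup N] [Module R N] [AddCommGroup N'] [Module R N']
    {a : N} {a' : N'} (h : ∃ g : N →ₗ[R] N', g a = a') {X : Type*} [AddCommGroup X] [Module R X] :
    homValues (R := R) a' X ≤ homValues (R := R) a X := by
  obtain ⟨g, rfl⟩ := h
  rintro _ ⟨φ, rfl⟩
  exact ⟨φ ∘ₗ g, rfl⟩

variable (R) in
/-- The descending chain condition for the subgroups `{φ a | φ : N → X}` of `X`, where `N` is a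
module and `a ∈ N`: only chains of functors are considered. -/
def HomValuesDCC (X : Type v) [AddCommGroup X] [Module R X] : Prop :=
  ∀ (N : ℕ → Type (max u v)) [∀ n, AddCommGroup (N n)] [∀ n, Module R (N n)] (a : ∀ n, N n),
    (∀ n, ∃ g : N n →ₗ[R] N (n + 1), g (a n) = a (n + 1)) →
      ∃ m, ∀ n, m ≤ n → homValues (R := R) (a n) X = homValues (R := R) (a m) X

-- With `P n` denoting the `n`-th functor of values, the congruences `z ≡ s n` modulo `P (n + 1) Y`
-- are finitely solvable by partial sums of `x 0, x 1, …` placed in different copies. A common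
-- solution has finite support, so almost every `x n` lies in `P (n + 1) X`; the `x n` are chosen to
-- witness strict descent.
open DirectSum in
theorem IsSigmaAlgebraicallyCompact.homValuesDCC {X : Type v} [AddCommGroup X] [Module R X]
    (hX : IsSigmaAlgebraicallyCompact R X) : HomValuesDCC R X := by
  intro N _ _ a hg
  have hdesc : ∀ n, homValues (R := R) (a (n + 1)) X ≤ homValues (R := R) (a n) X :=
    fun n => homValues_le (hg n)
  let K := ULift.{max u v} ℕ
  let Y := ⨁ _ : K, X
  have hanti : Antitone fun n => homValues (R := R) (a n) X := antitone_nat_of_succ_le hdesc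
  have hx : ∀ n, ∃ x ∈ homValues (R := R) (a n) X, x ∈ homValues (R := R) (a (n + 1)) X →
      homValues (R := R) (a n) X ≤ homValues (R := R) (a (n + 1)) X := by
    intro n
    by_cases hle : homValues (R := R) (a n) X ≤ homValues (R := R) (a (n + 1)) X
    · exact ⟨0, zero_mem _, fun _ => hle⟩
    · obtain ⟨x, hx, hx'⟩ := SetLike.not_le_iff_exists.1 hle
      exact ⟨x, hx, fun h => absurd h hx'⟩
  choose x hx hx' using hx
  let s : ℕ → Y := fun n => ∑ k ∈ Finset.range (n + 1), lof R K (fun _ => X) ⟨k⟩ (x k)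
  let Q := (⨁ n, N (n + 1)) × R
  -- The factor `R` of `Q` carries the unknown `z = φ (0, 1)`. The coefficient `-1` turns `φ (b n) =
  -- - s n` into the statement that `z - s n` is the value at `a (n + 1)` of a homomorphism.
  let b : ℕ → Q := fun n => (lof R ℕ (fun n => N (n + 1)) n (a (n + 1)), -1)
  obtain ⟨φ, hφ⟩ := (hX K).exists_hom (Q := Q) (fun m : ℕ => {p | ∃ n ≤ m, p = (b n, - s n)})
    (Monotone.directed_le fun m m' hm p ⟨n, hn, hp⟩ => ⟨n, hn.trans hm, hp⟩) fun m => by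
      have hs : ∀ n, ∃ ψ : N (n + 1) →ₗ[R] Y, n ≤ m → ψ (a (n + 1)) = s m - s n := by
        intro n
        by_cases hn : n ≤ m
        · have : s m - s n ∈ homValues (R := R) (a (n + 1)) Y := by
            have : s m - s n = ∑ k ∈ Finset.Ico (n + 1) (m + 1),
                lof R K (fun _ => X) ⟨k⟩ (x k) := by
              rw [Finset.sum_Ico_eq_sub _ (by omega)]
            rw [this]
            refine sum_mem fun k hk => ?_
            obtain ⟨ψ, hψ⟩ := hanti (Finset.mem_Ico.1 hk).1 (hx k)
            exact ⟨lof R K (fun _ => X) ⟨k⟩ ∘ₗ ψ, congrArg (lof R K (fun _ => X) ⟨k⟩) hψ⟩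
          obtain ⟨ψ, hψ⟩ := this
          exact ⟨ψ, fun _ => hψ⟩
        · exact ⟨0, fun h => absurd h hn⟩
      choose ψ hψ using hs
      refine ⟨(toModule R ℕ Y ψ).coprod (LinearMap.toSpanSingleton R Y (s m)), ?_⟩
      rintro _ ⟨n, hn, rfl⟩
      change toModule R ℕ Y ψ (lof R ℕ (fun n => N (n + 1)) n (a (n + 1))) + (-1 : R) • s m = _
      rw [toModule_lof, hψ n hn, neg_smul, one_smul]
      have hcancel : ∀ {G : Type (max u v)} [AddCommGroup G] (y y' : G), y - y' + -y = -y' := by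
        intros
        abel
      exact hcancel _ _
  classical
  let z : Y := φ (0, 1)
  have hz : ∀ n, z ⟨n⟩ - x n ∈ homValues (R := R) (a (n + 1)) X := by
    intro n
    refine ⟨component R K (fun _ => X) ⟨n⟩ ∘ₗ φ ∘ₗ LinearMap.inl R _ _ ∘ₗ
      lof R ℕ (fun n => N (n + 1)) n, ?_⟩
    have h₁ : φ (lof R ℕ (fun n => N (n + 1)) n (a (n + 1)), 0) = z - s n := by
      have := hφ n (b n, - s n) ⟨n, le_rfl, rfl⟩
      have h₂ : ((lof R ℕ (fun n => N (n + 1)) n (a (n + 1)), 0) : Q) = b n + (0, 1) :=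
        Prod.ext (add_zero _).symm (neg_add_cancel (1 : R)).symm
      rw [h₂, map_add, this]
      exact neg_add_eq_sub _ _
    have h₃ : component R K (fun _ => X) ⟨n⟩ (s n) = x n := by
      rw [map_sum, Finset.sum_eq_single n]
      · exact component.lof_self ..
      · intro k _ hk
        exact component.of .. |>.trans (dif_neg fun h => hk (congrArg ULift.down h))
      · simp
    change component R K (fun _ => X) ⟨n⟩ (φ (lof R ℕ (fun n => N (n + 1)) n (a (n + 1)), 0)) = _
    rw [h₁, map_sub, h₃]
    rfl
  refine ⟨(DFinsupp.support z).sup (fun k => k.down) + 1, fun n hn => ?_⟩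
  induction n, hn using Nat.le_induction with
  | base => rfl
  | succ n hn ih =>
    rw [← ih]
    refine le_antisymm (hdesc n) (hx' n ?_)
    have hzn : z ⟨n⟩ = 0 := by
      by_contra hne
      have := Finset.le_sup (f := fun k : K => k.down)
        ((DFinsupp.mem_support_toFun z (⟨n⟩ : K)).2 hne)
      simp only at this
      omega
    simpa [hzn] using hz n

end Systems

/-! ### Consequences of the chain condition: inheritance and solvability of systems -/

section HomValues

variable {R : Type u} [Ring R] {X : Type v} [AddCommGroup X] [Module R X]

open Submodule

/-- The descending chain condition passes to modules which are locally direct summands. -/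
theorem HomValuesDCC.of_locally_split (hX : HomValuesDCC.{u, v} R X) {U : Type v} [AddCommGroup U]
    [Module R U] (i : U →ₗ[R] X) (hi : ∀ u, ∃ π : X →ₗ[R] U, π (i u) = u) :
    HomValuesDCC.{u, v} R U := by
  intro N _ _ a hg
  obtain ⟨m, hm⟩ := hX N a hg
  have key : ∀ n, homValues (R := R) (a n) U = (homValues (R := R) (a n) X).comap i := by
    intro n
    ext u
    constructor
    · rintro ⟨φ, rfl⟩
      exact ⟨i ∘ₗ φ, rfl⟩
    · rintro ⟨φ, hφ⟩
      obtain ⟨π, hπ⟩ := hi u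
      exact ⟨π ∘ₗ φ, (congrArg π hφ).trans hπ⟩
  exact ⟨m, fun n hn => by rw [key, key, hm n hn]⟩

theorem HomValuesDCC.of_isComplemented (hX : HomValuesDCC.{u, v} R X) {U : Submodule R X}
    (hU : IsComplemented U) : HomValuesDCC.{u, v} R U := by
  obtain ⟨V, hV⟩ := hU
  exact hX.of_locally_split U.subtype fun u =>
    ⟨U.projectionOnto V hV, projectionOnto_apply_left hV u⟩

theorem HomValuesDCC.of_equiv (hX : HomValuesDCC.{u, v} R X) {Y : Type v} [AddCommGroup Y]
    [Module R Y] (e : Y ≃ₗ[R] X) : HomValuesDCC.{u, v} R Y :=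
  hX.of_locally_split e.toLinearMap fun y => ⟨e.symm.toLinearMap, e.symm_apply_apply y⟩

theorem HomValuesDCC.hasDCC_cyclic (hX : HomValuesDCC.{u, v} R X) :
    HasDCC (Module.End R X) X IsCyclicSubmodule := by
  intro U hU hdesc
  choose x hx using hU
  have hmem : ∀ n (y : X), y ∈ U n ↔
      y ∈ homValues (R := R) (ULift.up.{max u v} (x n)) X := by
    intro n y
    rw [hx n, mem_span_singleton, mem_homValues]
    constructor
    · rintro ⟨s, rfl⟩
      exact ⟨s ∘ₗ ULift.moduleEquiv.toLinearMap, rfl⟩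
    · rintro ⟨φ, rfl⟩
      exact ⟨φ ∘ₗ ULift.moduleEquiv.symm.toLinearMap, rfl⟩
  obtain ⟨m, hm⟩ := hX (fun _ => ULift.{max u v} X) (fun n => ⟨x n⟩) fun n => by
    have h : x (n + 1) ∈ span (Module.End R X) {x n} := by
      rw [← hx n]
      refine hdesc n ?_
      rw [hx (n + 1)]
      exact mem_span_singleton_self _
    obtain ⟨s, hs⟩ := mem_span_singleton.1 h
    exact ⟨ULift.moduleEquiv.symm.toLinearMap ∘ₗ s ∘ₗ ULift.moduleEquiv.toLinearMap,
      congrArg ULift.up hs⟩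
  refine ⟨m, fun n hn => ?_⟩
  ext y
  rw [hmem, hmem, hm n hn]

variable {Q : Type (max u v)} [AddCommGroup Q] [Module R Q]

/-- For each `q` there is a finite part of a system which determines the values at `q` of the
solutions of the homogeneous system as precisely as possible. -/
theorem HomValuesDCC.exists_finset (hX : HomValuesDCC.{u, v} R X) (E : Set (Q × X)) (q : Q) :
    ∃ T : Finset (Q × X), ↑T ⊆ E ∧ ∀ T' : Finset (Q × X), ↑T' ⊆ E → T ⊆ T' →
      ∀ φ : Q →ₗ[R] X, (∀ p ∈ T, φ p.1 = 0) → ∃ ψ : Q →ₗ[R] X, (∀ p ∈ T', ψ p.1 = 0) ∧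
        ψ q = φ q := by
  by_contra! hcon
  obtain ⟨T, -, hT⟩ := exists_seq_of_step (α := {T : Finset (Q × X) // ↑T ⊆ E})
    (r := fun T T' => T.1 ⊆ T'.1 ∧ ∃ φ : Q →ₗ[R] X, (∀ p ∈ T.1, φ p.1 = 0) ∧
      ∀ ψ : Q →ₗ[R] X, (∀ p ∈ T'.1, ψ p.1 = 0) → ψ q ≠ φ q)
    (fun T => by
      obtain ⟨T', hT'E, hTT', hφ⟩ := hcon T.1 T.2
      exact ⟨⟨T', hT'E⟩, hTT', hφ⟩) ⟨∅, by simp⟩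
  -- Solutions of the homogeneous system of `T n` are the homomorphisms out of `Q ⧸ D n`, so their
  -- values at `q` form a chain to which `hX` applies.
  let D : ℕ → Submodule R Q := fun n => span R {q | ∃ p ∈ (T n).1, p.1 = q}
  have hD : ∀ n (φ : Q →ₗ[R] X), (∀ p ∈ (T n).1, φ p.1 = 0) ↔ D n ≤ LinearMap.ker φ := by
    intro n φ
    rw [span_le]
    constructor
    · rintro h _ ⟨p, hp, rfl⟩
      exact h p hp
    · exact fun h p hp => h ⟨p, hp, rfl⟩
  obtain ⟨m, hm⟩ := hX (fun n => Q ⧸ D n) (fun n => (D n).mkQ q) fun n =>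
    ⟨Submodule.factor (span_mono fun _ ⟨p, hp, h⟩ => ⟨p, (hT n).1 hp, h⟩), rfl⟩
  obtain ⟨φ, hφ, hψ⟩ := (hT m).2
  have hmem : φ q ∈ homValues (R := R) ((D m).mkQ q) X :=
    ⟨(D m).liftQ φ ((hD m φ).1 hφ), rfl⟩
  rw [← hm (m + 1) m.le_succ] at hmem
  obtain ⟨ψ, hψq⟩ := hmem
  refine hψ (ψ ∘ₗ (D (m + 1)).mkQ) ((hD _ _).2 ?_) hψq
  intro d hd
  have : (D (m + 1)).mkQ d = 0 := by simpa using hd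
  rw [LinearMap.mem_ker, LinearMap.comp_apply, this, map_zero]

/-- A maximal finitely solvable system prescribes a value at every `q`. It is then the graph of a
function, linear because linearity involves at most three conditions at a time. -/
theorem HomValuesDCC.exists_hom_of_finite (hX : HomValuesDCC.{u, v} R X) (E : Set (Q × X))
    (hE : ∀ T : Finset (Q × X), ↑T ⊆ E → ∃ φ : Q →ₗ[R] X, ∀ p ∈ T, φ p.1 = p.2) :
    ∃ φ : Q →ₗ[R] X, ∀ p ∈ E, φ p.1 = p.2 := by
  classical
  obtain ⟨F, hEF, hF⟩ := zorn_subset_nonempty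
    {E : Set (Q × X) | ∀ T : Finset (Q × X), (T : Set (Q × X)) ⊆ E →
      ∃ φ : Q →ₗ[R] X, ∀ p ∈ T, φ p.1 = p.2}
    (fun c hc hchain hne => ⟨⋃₀ c, fun T hT => by
      have := hne.to_subtype
      obtain ⟨D, hD, hTD⟩ := DirectedOn.exists_mem_subset_of_finset_subset_biUnion (f := id) hne
        hchain.directedOn (s := T) (by rwa [Set.sUnion_eq_biUnion] at hT)
      exact hc hD T hTD, fun D hD => Set.subset_sUnion_of_mem hD⟩) E hE
  have hval : ∀ q, ∃ x, (q, x) ∈ F := by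
    intro q
    obtain ⟨T, hTF, hT⟩ := hX.exists_finset F q
    obtain ⟨φ, hφ⟩ := hF.1 T hTF
    refine ⟨φ q, ?_⟩
    -- A solution `χ` of a larger finite part is corrected at `q`: `φ - χ` solves the homogeneous
    -- system of `T`, so by the choice of `T` its value at `q` is attained by a homogeneous solution
    -- of the larger part.
    have hins : insert (q, φ q) F ⊆ F := by
      refine hF.2 (fun T' hT' => ?_) (Set.subset_insert _ _)
      have hsub : ↑(T ∪ T'.erase (q, φ q)) ⊆ F := by
        intro p hp
        rcases Finset.mem_union.1 (Finset.mem_coe.1 hp) with h | h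
        · exact hTF h
        · obtain ⟨h₁, h₂⟩ := Finset.mem_erase.1 h
          exact (hT' h₂).resolve_left h₁
      obtain ⟨χ, hχ⟩ := hF.1 _ hsub
      obtain ⟨ψ, hψ, hψq⟩ := hT _ hsub Finset.subset_union_left (φ - χ) fun p hp => by
        rw [LinearMap.sub_apply, hφ p hp, hχ p (Finset.mem_union_left _ hp), sub_self]
      have hq : (χ + ψ) q = φ q := by
        rw [LinearMap.add_apply, hψq, LinearMap.sub_apply, add_sub_cancel]
      refine ⟨χ + ψ, fun p hp => ?_⟩
      by_cases hpq : p = (q, φ q)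
      · rw [hpq, hq]
      · have hmem := Finset.mem_union_right T (Finset.mem_erase.2 ⟨hpq, hp⟩)
        rw [LinearMap.add_apply, hχ p hmem, hψ p hmem, add_zero]
    exact hins (Set.mem_insert _ _)
  choose f hf using hval
  have huniq : ∀ p ∈ F, f p.1 = p.2 := by
    intro p hp
    obtain ⟨φ, hφ⟩ := hF.1 {p, (p.1, f p.1)} (by
      intro r hr
      simp only [Finset.coe_insert, Finset.coe_singleton, Set.mem_insert_iff,
        Set.mem_singleton_iff] at hr
      rcases hr with rfl | rfl
      exacts [hp, hf _])
    have h : φ p.1 = f p.1 := hφ (p.1, f p.1) (by simp)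
    rw [← hφ p (by simp), h]
  refine ⟨⟨⟨f, fun q q' => ?_⟩, fun r q => ?_⟩, fun p hp => huniq p (hEF hp)⟩
  · obtain ⟨φ, hφ⟩ := hF.1 {(q, f q), (q', f q'), (q + q', f (q + q'))} (by
      intro r hr
      simp only [Finset.coe_insert, Finset.coe_singleton, Set.mem_insert_iff,
        Set.mem_singleton_iff] at hr
      rcases hr with rfl | rfl | rfl <;> exact hf _)
    have h : φ q = f q := hφ (q, f q) (by simp)
    have h' : φ q' = f q' := hφ (q', f q') (by simp)
    have hadd : φ (q + q') = f (q + q') := hφ (q + q', f (q + q')) (by simp)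
    rw [← h, ← h', ← hadd, map_add]
  · obtain ⟨φ, hφ⟩ := hF.1 {(q, f q), (r • q, f (r • q))} (by
      intro r hr
      simp only [Finset.coe_insert, Finset.coe_singleton, Set.mem_insert_iff,
        Set.mem_singleton_iff] at hr
      rcases hr with rfl | rfl <;> exact hf _)
    have h : φ q = f q := hφ (q, f q) (by simp)
    have hsmul : φ (r • q) = f (r • q) := hφ (r • q, f (r • q)) (by simp)
    change f (r • q) = r • f q
    rw [← h, ← hsmul, map_smul]

/-- Under the descending chain condition, a directed union of solvable systems of conditions
`φ q = x` on a homomorphism `φ` is solvable. -/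
theorem HomValuesDCC.exists_hom (hX : HomValuesDCC.{u, v} R X) {P : Type v} [AddCommGroup P]
    [Module R P] {Λ : Type*} [Nonempty Λ] (E : Λ → Set (P × X)) (hE : Directed (· ⊆ ·) E)
    (h : ∀ l, ∃ φ : P →ₗ[R] X, ∀ p ∈ E l, φ p.1 = p.2) :
    ∃ φ : P →ₗ[R] X, ∀ l, ∀ p ∈ E l, φ p.1 = p.2 := by
  classical
  obtain ⟨φ, hφ⟩ := hX.exists_hom_of_finite (Q := ULift.{max u v} P)
    (⋃ l, {p | (p.1.down, p.2) ∈ E l}) fun T hT => by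
      obtain ⟨l, hl⟩ := Directed.exists_mem_subset_of_finset_subset_biUnion
        (f := fun l => {p : ULift.{max u v} P × X | (p.1.down, p.2) ∈ E l})
        (fun l l' => by
          obtain ⟨m, hm, hm'⟩ := hE l l'
          exact ⟨m, fun _ hp => hm hp, fun _ hp => hm' hp⟩) hT
      obtain ⟨φ, hφ⟩ := h l
      exact ⟨φ ∘ₗ ULift.moduleEquiv.toLinearMap, fun p hp => hφ _ (hl hp)⟩
  exact ⟨φ ∘ₗ ULift.moduleEquiv.symm.toLinearMap, fun l p hp =>
    hφ (⟨p.1⟩, p.2) (Set.mem_iUnion.2 ⟨l, hp⟩)⟩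

end HomValues

/-! ### Decomposition into indecomposable summands -/

section Decomposition

variable {R : Type u} [Ring R] {X : Type v} [AddCommGroup X] [Module R X]

open Submodule

/-- The union of a chain of direct summands is a direct summand. -/
theorem HomValuesDCC.isComplemented_sSup (hX : HomValuesDCC.{u, v} R X)
    {c : Set (Submodule R X)} (hne : c.Nonempty) (hchain : IsChain (· ≤ ·) c)
    (hc : ∀ U ∈ c, IsComplemented U) : IsComplemented (sSup c) := by
  have hret : ∀ D (hD : D ∈ c), ∃ π : X →ₗ[R] ↥(sSup c), ∀ u (hu : u ∈ D),
      π u = ⟨u, le_sSup hD hu⟩ := by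
    intro D hD
    obtain ⟨V, hV⟩ := hc D hD
    refine ⟨inclusion (le_sSup hD) ∘ₗ D.projectionOnto V hV, fun u hu => ?_⟩
    rw [LinearMap.comp_apply, projectionOnto_apply_left hV ⟨u, hu⟩]
    rfl
  have hU : HomValuesDCC.{u, v} R ↥(sSup c) := hX.of_locally_split (sSup c).subtype fun u => by
    obtain ⟨D, hD, huD⟩ := (mem_sSup_of_directed hne hchain.directedOn).1 u.2
    obtain ⟨π, hπ⟩ := hret D hD
    exact ⟨π, hπ _ huD⟩
  have := hne.to_subtype
  -- The conditions say that `φ` is the identity on each member of the chain; projections solve them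
  -- one member at a time, and a common solution is a retraction onto the union.
  obtain ⟨φ, hφ⟩ := hU.exists_hom (P := X) (Λ := c)
    (fun D => {p | p.1 ∈ D.1 ∧ (p.2 : X) = p.1})
    (fun D D' => by
      rcases hchain.total D.2 D'.2 with h | h
      · exact ⟨D', fun p hp => ⟨h hp.1, hp.2⟩, fun p hp => hp⟩
      · exact ⟨D, fun p hp => hp, fun p hp => ⟨h hp.1, hp.2⟩⟩)
    fun D => by
      obtain ⟨π, hπ⟩ := hret D D.2
      exact ⟨π, fun p hp => (hπ _ hp.1).trans (Subtype.ext hp.2.symm)⟩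
  refine ⟨LinearMap.ker φ, LinearMap.isCompl_of_proj (f := φ) fun u => ?_⟩
  obtain ⟨D, hD, huD⟩ := (mem_sSup_of_directed hne hchain.directedOn).1 u.2
  exact hφ ⟨D, hD⟩ (u, u) ⟨huD, rfl⟩

/-- Each proper direct summand is contained in one with an indecomposable complement. -/
theorem HomValuesDCC.exists_isIndecomposable (hX : HomValuesDCC.{u, v} R X) {D : Submodule R X}
    (hD : IsComplemented D) (hne : D ≠ ⊤) :
    ∃ V W : Submodule R X, D ≤ V ∧ IsCompl V W ∧ IsIndecomposable R W := by
  obtain ⟨x, -, hx⟩ := SetLike.exists_of_lt (lt_top_iff_ne_top.2 hne)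
  obtain ⟨V, hDV, hV⟩ := zorn_le_nonempty₀ {V : Submodule R X | IsComplemented V ∧ x ∉ V}
    (fun c hc hchain y hy => ⟨sSup c, ⟨hX.isComplemented_sSup ⟨y, hy⟩ hchain fun U hU => (hc hU).1,
      fun hx => by
        obtain ⟨U, hU, hxU⟩ := (mem_sSup_of_directed ⟨y, hy⟩ hchain.directedOn).1 hx
        exact (hc hU).2 hxU⟩, fun _ => le_sSup⟩) D ⟨hD, hx⟩
  obtain ⟨W, hVW⟩ := hV.1.1
  refine ⟨V, W, hDV, hVW, ?_, fun A B hAB => ?_⟩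
  · rw [nontrivial_iff_ne_bot]
    rintro rfl
    have : V = ⊤ := by simpa using hVW.sup_eq_top
    exact hV.1.2 (this ▸ mem_top)
  · have hdisj : ∀ {A B : Submodule R W}, IsCompl A B →
        Disjoint (V ⊔ A.map W.subtype) (B.map W.subtype) := by
      intro A B hAB
      have hinf : Disjoint (A.map W.subtype) (B.map W.subtype) := by
        rw [disjoint_iff, ← map_inf _ W.subtype_injective, hAB.inf_eq_bot, Submodule.map_bot]
      refine hinf.disjoint_sup_left_of_disjoint_sup_right (hVW.disjoint.mono_right ?_)
      exact sup_le (map_subtype_le _ _) (map_subtype_le _ _)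
    have hmem : ∀ {A B : Submodule R W}, IsCompl A B → A ≠ ⊥ → x ∈ V ⊔ A.map W.subtype := by
      intro A B hAB hA
      by_contra hxA
      have hcompl : IsCompl (V ⊔ A.map W.subtype) (B.map W.subtype) := by
        refine ⟨hdisj hAB, ?_⟩
        rw [codisjoint_iff, sup_assoc, ← Submodule.map_sup, hAB.sup_eq_top, Submodule.map_top,
          range_subtype, hVW.sup_eq_top]
      have hle := le_sup_right.trans (hV.2 ⟨⟨_, hcompl⟩, hxA⟩ le_sup_left)
      have := le_bot_iff.1 ((le_inf hle (map_subtype_le _ _)).trans hVW.inf_eq_bot.le)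
      exact hA (Submodule.map_injective_of_injective W.subtype_injective
        (this.trans (Submodule.map_bot _).symm))
    by_contra! hAB'
    -- Both enlargements of `V` are summands, so maximality puts `x` in each; by the modular law
    -- they meet in `V`, which avoids `x`.
    have hxV : x ∈ (V ⊔ A.map W.subtype) ⊓ (V ⊔ B.map W.subtype) :=
      ⟨hmem hAB hAB'.1, hmem hAB.symm hAB'.2⟩
    rw [sup_inf_assoc_of_le _ le_sup_left, (hdisj hAB.symm).symm.eq_bot, sup_bot_eq] at hxV
    exact hV.1.2 hxV

theorem HomValuesDCC.exists_decomposition (hX : HomValuesDCC.{u, v} R X) :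
    ∃ 𝒜 : Set (Submodule R X), sSupIndep 𝒜 ∧ sSup 𝒜 = ⊤ ∧ ∀ A ∈ 𝒜, IsIndecomposable R A := by
  obtain ⟨𝒜, -, h𝒜⟩ := zorn_subset_nonempty
    {𝒜 : Set (Submodule R X) | sSupIndep 𝒜 ∧ (∀ A ∈ 𝒜, IsIndecomposable R A) ∧
      IsComplemented (sSup 𝒜)}
    (fun c hc hchain hne => ⟨⋃₀ c, ⟨
      iSupIndep_sUnion_of_directed hchain.directedOn fun 𝒜 h𝒜 => (hc h𝒜).1,
      fun A ⟨𝒜, h𝒜, hA⟩ => (hc h𝒜).2.1 A hA, by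
        rw [sSup_sUnion, ← sSup_image]
        refine hX.isComplemented_sSup (hne.image _)
          (hchain.image_of_map_rel _ _ sSup fun _ _ h => sSup_le_sSup h) ?_
        rintro _ ⟨𝒜, h𝒜, rfl⟩
        exact (hc h𝒜).2.2⟩, fun _ => Set.subset_sUnion_of_mem⟩)
    ∅ ⟨sSupIndep_empty, by simp, by simpa using isComplemented_bot⟩
  refine ⟨𝒜, h𝒜.1.1, ?_, h𝒜.1.2.1⟩
  by_contra hne
  obtain ⟨V, W, hDV, hVW, hW⟩ := hX.exists_isIndecomposable h𝒜.1.2.2 hne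
  obtain ⟨Y, hY⟩ := h𝒜.1.2.2
  -- By modularity `V ⊓ Y` complements the old sum inside `V`; hence it complements the sum enlarged
  -- by `W` in `X`.
  have hV : sSup 𝒜 ⊔ V ⊓ Y = V := by
    rw [inf_comm, ← sup_inf_assoc_of_le _ hDV, hY.sup_eq_top, top_inf_eq]
  have hins : insert W 𝒜 ⊆ 𝒜 := by
    refine h𝒜.2 ⟨fun A hA => ?_, fun A hA => ?_, V ⊓ Y, ?_⟩ (Set.subset_insert _ _)
    · rcases eq_or_ne A W with rfl | hAW
      · refine hVW.disjoint.symm.mono_right (le_trans (sSup_le_sSup ?_) hDV)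
        rintro B ⟨hB | hB, hBA⟩
        exacts [absurd hB hBA, hB]
      · have hA' : A ∈ 𝒜 := hA.resolve_left hAW
        have hsub : insert W 𝒜 \ {A} ⊆ insert W (𝒜 \ {A}) := by
          rintro B ⟨hB | hB, hBA⟩
          exacts [Or.inl hB, Or.inr ⟨hB, hBA⟩]
        refine Disjoint.mono_right (sSup_le_sSup hsub) ?_
        rw [sSup_insert, sup_comm]
        refine (h𝒜.1.1 hA').disjoint_sup_right_of_disjoint_sup_left
          (hVW.disjoint.mono_left (sup_le ?_ ?_))
        · exact (le_sSup hA').trans hDV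
        · exact (sSup_le_sSup Set.sdiff_subset).trans hDV
    · rcases hA with rfl | hA
      exacts [hW, h𝒜.1.2.1 A hA]
    · rw [sSup_insert]
      constructor
      · refine Disjoint.disjoint_sup_left_of_disjoint_sup_right
          (hY.disjoint.mono_right inf_le_right) (hVW.disjoint.symm.mono_right ?_)
        rw [hV]
      · rw [codisjoint_iff, sup_assoc, hV, sup_comm, hVW.sup_eq_top]
  have hWV : W ≤ V := (le_sSup (hins (Set.mem_insert _ _))).trans hDV
  have hbot : W = ⊥ := le_bot_iff.1 ((le_inf hWV le_rfl).trans hVW.inf_eq_bot.le)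
  exact (nontrivial_iff_ne_bot.1 hW.1) hbot

end Decomposition

/-! ### Local endomorphism rings of indecomposable summands -/

section LocalEndomorphismRings

variable {R : Type u} [Ring R] {X : Type v} [AddCommGroup X] [Module R X]

open DirectSum in
/-- Among the endomorphisms that fix a set pointwise there is one which generates a minimal left
ideal in the monoid of all of them. -/
theorem HomValuesDCC.exists_minimal_fixing (hX : HomValuesDCC.{u, v} R X) (B : Set X) :
    ∃ f : Module.End R X, (∀ b ∈ B, f b = b) ∧ ∀ h : Module.End R X, (∀ b ∈ B, h b = b) →
      ∃ g : Module.End R X, ∀ x, g (h (f x)) = f x := by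
  classical
  let r : {f : Module.End R X // ∀ b ∈ B, f b = b} → {f : Module.End R X // ∀ b ∈ B, f b = b} →
    Prop := fun f f' => ∃ h : Module.End R X, ∀ x, h (f.1 x) = f'.1 x
  have hrefl : ∀ f, r f f := fun f => ⟨1, fun _ => rfl⟩
  have htrans : ∀ {f f' f''}, r f f' → r f' f'' → r f f'' := by
    rintro f f' f'' ⟨h, hh⟩ ⟨h', hh'⟩
    exact ⟨h' * h, fun x => by rw [Module.End.mul_apply, hh, hh']⟩
  obtain ⟨f, hf⟩ := exists_maximal_of_chains_bounded (r := r) (fun c hc => by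
    rcases c.eq_empty_or_nonempty with rfl | ⟨f₀, hf₀⟩
    · exact ⟨⟨1, fun _ _ => rfl⟩, by simp⟩
    have : Nonempty c := ⟨f₀, hf₀⟩
    have htotal : ∀ a b : c, r a b ∨ r b a := by
      intro a b
      rcases eq_or_ne a b with rfl | hab
      · exact Or.inl (hrefl _)
      · exact hc a.2 b.2 fun h => hab (Subtype.ext h)
    let L : c → X →ₗ[R] ⨁ _ : c, X := fun a => lof R c (fun _ => X) a
    -- The system asks for maps `φ a` such that all composites `φ a ∘ a` agree and each `φ a` fixes
    -- `B`. The part belonging to `m` is solved by maps carrying the earlier members to `m`; the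
    -- common composite is the upper bound.
    let E : c → Set ((⨁ _ : c, X) × X) := fun m =>
      {p | (∃ a b : c, r a m ∧ r b m ∧ ∃ x, p = (L a (a.1.1 x) - L b (b.1.1 x), 0)) ∨
        ∃ a : c, r a m ∧ ∃ x ∈ B, p = (L a x, x)}
    have hmono : ∀ {m m' : c}, r m m' → E m ⊆ E m' := by
      rintro m m' hm p (⟨a, b, ha, hb, hp⟩ | ⟨a, ha, hp⟩)
      · exact Or.inl ⟨a, b, htrans ha hm, htrans hb hm, hp⟩
      · exact Or.inr ⟨a, htrans ha hm, hp⟩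
    obtain ⟨φ, hφ⟩ := hX.exists_hom E
      (fun m m' => by
        rcases htotal m m' with h | h
        · exact ⟨m', hmono h, subset_rfl⟩
        · exact ⟨m, subset_rfl, hmono h⟩)
      fun m => by
        have hh : ∀ a : c, ∃ h : X →ₗ[R] X, r a m → ∀ x, h (a.1.1 x) = m.1.1 x := by
          intro a
          by_cases ha : r a m
          · obtain ⟨h, hh⟩ := ha
            exact ⟨h, fun _ => hh⟩
          · exact ⟨0, fun h => absurd h ha⟩
        choose h hh using hh
        refine ⟨toModule R c X h, ?_⟩
        rintro p (⟨a, b, ha, hb, x, rfl⟩ | ⟨a, ha, x, hx, rfl⟩)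
        · simp only [L, map_sub, toModule_lof, hh a ha, hh b hb, sub_self]
        · simp only [L, toModule_lof]
          rw [← a.1.2 x hx, hh a ha, m.1.2 x hx, a.1.2 x hx]
    refine ⟨⟨φ ∘ₗ L ⟨f₀, hf₀⟩ ∘ₗ f₀.1, fun b hb => ?_⟩, fun a ha => ⟨φ ∘ₗ L ⟨a, ha⟩, fun x => ?_⟩⟩
    · rw [LinearMap.comp_apply, LinearMap.comp_apply, f₀.2 b hb]
      exact hφ ⟨f₀, hf₀⟩ (L ⟨f₀, hf₀⟩ b, b) (Or.inr ⟨⟨f₀, hf₀⟩, hrefl _, b, hb, rfl⟩)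
    · obtain ⟨m, h₁, h₂⟩ : ∃ m : c, r a m ∧ r f₀ m := by
        rcases htotal ⟨a, ha⟩ ⟨f₀, hf₀⟩ with h | h
        · exact ⟨⟨f₀, hf₀⟩, h, hrefl _⟩
        · exact ⟨⟨a, ha⟩, hrefl _, h⟩
      have := hφ m _ (Or.inl ⟨⟨a, ha⟩, ⟨f₀, hf₀⟩, h₁, h₂, x, rfl⟩)
      rw [map_sub] at this
      exact sub_eq_zero.1 this) htrans
  refine ⟨f.1, f.2, fun h hh => ?_⟩
  exact hf ⟨h * f.1, fun b hb => by rw [Module.End.mul_apply, f.2 b hb, hh b hb]⟩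
    ⟨h, fun _ => rfl⟩

/-- Take a maximal set `B` containing `x` on which `k` has a left inverse. A minimal endomorphism
`f` fixing `B` turns out to be an idempotent with range `B`; indecomposability and `f x = x ≠ 0`
force `f = 1`. So `k` is a split monomorphism into an indecomposable module. -/
theorem HomValuesDCC.bijective_of_fixed (hX : HomValuesDCC.{u, v} R X)
    (hind : IsIndecomposable R X) {k : Module.End R X} {x : X} (hx0 : x ≠ 0) (hkx : k x = x) :
    Function.Bijective k := by
  obtain ⟨B, hxB, hB⟩ := zorn_subset_nonempty
    {B : Set X | ∃ g : Module.End R X, ∀ b ∈ B, g (k b) = b}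
    (fun c hc hchain hne => by
      have := hne.to_subtype
      obtain ⟨g, hg⟩ := hX.exists_hom (P := X) (Λ := c)
        (fun B => {p | p.2 ∈ B.1 ∧ p.1 = k p.2})
        (fun B B' => by
          rcases hchain.total B.2 B'.2 with h | h
          · exact ⟨B', fun p hp => ⟨h hp.1, hp.2⟩, subset_rfl⟩
          · exact ⟨B, subset_rfl, fun p hp => ⟨h hp.1, hp.2⟩⟩)
        fun B => by
          obtain ⟨g, hg⟩ := hc B.2
          exact ⟨g, fun p hp => by rw [hp.2, hg _ hp.1]⟩
      exact ⟨⋃₀ c, ⟨g, fun b ⟨B, hB, hb⟩ => hg ⟨B, hB⟩ (k b, b) ⟨hb, rfl⟩⟩,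
        fun _ => Set.subset_sUnion_of_mem⟩)
    {x} ⟨1, by simpa using hkx⟩
  obtain ⟨g, hg⟩ := hB.1
  obtain ⟨f, hfB, hf⟩ := hX.exists_minimal_fixing B
  obtain ⟨h, hh⟩ := hf (g * k) hg
  -- The composite `h * g` inverts `k` on the range of `f`, which contains `B`, so maximality of `B`
  -- applies.
  have hrange : ∀ y, f y ∈ B := by
    have : Set.range f ⊆ B := hB.2 ⟨h * g, by
      rintro _ ⟨y, rfl⟩
      exact hh y⟩ fun b hb => ⟨b, hfB b hb⟩
    exact fun y => this ⟨y, rfl⟩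
  have hff : ∀ y, f (f y) = f y := fun y => hfB _ (hrange y)
  have hcompl : IsCompl (LinearMap.range f) (LinearMap.ker f) := by
    constructor
    · rw [Submodule.disjoint_def]
      rintro _ ⟨y, rfl⟩ hy
      rw [← hff, LinearMap.mem_ker.1 hy]
    · rw [codisjoint_iff, eq_top_iff]
      intro y _
      refine Submodule.mem_sup.2 ⟨f y, ⟨y, rfl⟩, y - f y, ?_, add_sub_cancel _ _⟩
      rw [LinearMap.mem_ker, map_sub, hff, sub_self]
  have hinj : LinearMap.ker f = ⊥ := by
    refine (hind.2 _ _ hcompl).resolve_left fun h0 => hx0 ?_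
    have : f x ∈ (⊥ : Submodule R X) := h0 ▸ ⟨x, rfl⟩
    rwa [hfB x (hxB rfl), Submodule.mem_bot] at this
  have hid : ∀ y, g (k y) = y := fun y => hg y (by
    rw [← LinearMap.ker_eq_bot.1 hinj (hff y)]
    exact hrange y)
  have := hind.1
  refine hind.bijective_of_comp (g := g) ?_
  have hgk : g ∘ₗ k = LinearMap.id := LinearMap.ext hid
  rw [hgk]
  exact Function.bijective_id

/-- For a nonzero `x` generating a minimal cyclic submodule over the endomorphism ring, either `f x
= 0` and `1 - f` fixes `x`, or some `g ∘ f` fixes `x`. -/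
theorem HomValuesDCC.isLocalRing (hX : HomValuesDCC.{u, v} R X) (hind : IsIndecomposable R X) :
    IsLocalRing (Module.End R X) := by
  have := hind.1
  refine IsLocalRing.of_isUnit_or_isUnit_one_sub_self fun f => ?_
  simp only [Module.End.isUnit_iff]
  obtain ⟨x, hx0, hx⟩ := hX.hasDCC_cyclic.exists_minimal (· ≠ 0) (exists_ne 0)
  by_cases hfx : f x = 0
  · exact Or.inr (hX.bijective_of_fixed hind hx0 (by simp [hfx]))
  · obtain ⟨g, hg⟩ := Submodule.mem_span_singleton.1 (hx f hfx)
    exact Or.inl (hind.bijective_of_comp (hX.bijective_of_fixed hind (k := g ∘ₗ f) hx0 hg))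

end LocalEndomorphismRings

/-! ### Assembly of the equivalence and of the decomposition theorem -/

variable {R : Type u} [Ring R]

theorem tfae_isRightTNilpotent {ι : Type w} {M : ι → Type v} [∀ i, AddCommGroup (M i)]
    [∀ i, Module R (M i)] (hM : ∀ i, IsIndecomposable R (M i))
    (hloc : ∀ i, IsLocalRing (Module.End R (M i))) :
    List.TFAE [
      IsRightTNilpotent R M,
      IsSemiArtinian (Module.End R (⨁ i, M i)) (⨁ i, M i),
      HasDCC (Module.End R (⨁ i, M i)) (⨁ i, M i) IsCyclicSubmodule,
      HasDCC (Module.End R (⨁ i, M i)) (⨁ i, M i) Submodule.FG] := by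
  classical
  tfae_have 1 → 4 := IsRightTNilpotent.hasDCC_fg
  tfae_have 4 → 3 := fun h U hU => h U fun n => by
    obtain ⟨x, hx⟩ := hU n
    exact hx ▸ Submodule.fg_span_singleton x
  tfae_have 3 → 2 := isSemiArtinian_of_hasDCC_cyclic
  tfae_have 2 → 1 := isRightTNilpotent_of_isSemiArtinian hM hloc
  tfae_finish

theorem HomValuesDCC.exists_isInternal {X : Type v} [AddCommGroup X] [Module R X]
    (hX : HomValuesDCC.{u, v} R X) :
    ∃ (ι : Type v) (_ : DecidableEq ι) (N : ι → Submodule R X),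
      DirectSum.IsInternal N ∧ (∀ i, IsIndecomposable R (N i)) ∧
        IsRightTNilpotent R (fun i => N i) := by
  classical
  obtain ⟨𝒜, hindep, htop, hind⟩ := hX.exists_decomposition
  have hint : DirectSum.IsInternal (fun A : 𝒜 => A.1) :=
    DirectSum.isInternal_submodule_of_iSupIndep_of_iSup_eq_top ((sSupIndep_iff _).1 hindep)
      (by rw [← sSup_eq_iSup', htop])
  have hloc : ∀ A : 𝒜, IsLocalRing (Module.End R A.1) := fun A =>
    (hX.of_isComplemented ⟨sSup (𝒜 \ {A.1}), hindep A.2, by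
      rw [codisjoint_iff, ← sSup_insert, Set.insert_sdiff_singleton, Set.insert_eq_of_mem A.2,
        htop]⟩).isLocalRing (hind A A.2)
  have hsum : HomValuesDCC.{u, v} R (⨁ A : 𝒜, A.1) :=
    hX.of_equiv (LinearEquiv.ofBijective (DirectSum.coeLinearMap fun A : 𝒜 => A.1) hint)
  exact ⟨𝒜, inferInstance, fun A => A.1, hint, fun A => hind A A.2,
    ((tfae_isRightTNilpotent (M := fun A : 𝒜 => A.1) (fun A => hind A A.2) hloc).out 0 2).2
      hsum.hasDCC_cyclic⟩

end EndoStructure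
theorem propositionE {R : Type u} [Ring R] :
    (∀ {ι : Type w} (M : ι → Type v) [∀ i, AddCommGroup (M i)] [∀ i, Module R (M i)],
      (∀ i, EndoStructure.IsIndecomposable R (M i)) →
        (EndoStructure.IsRightTNilpotent R M → ∀ i, IsLocalRing (Module.End R (M i))) ∧
        ((∀ i, IsLocalRing (Module.End R (M i))) →
          List.TFAE [
            EndoStructure.IsRightTNilpotent R M,
            EndoStructure.IsSemiArtinian (Module.End R (⨁ i, M i)) (⨁ i, M i),
            EndoStructure.HasDCC (Module.End R (⨁ i, M i)) (⨁ i, M i)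
              EndoStructure.IsCyclicSubmodule,
            EndoStructure.HasDCC (Module.End R (⨁ i, M i)) (⨁ i, M i) Submodule.FG]) ∧
        ((∀ i, IsLocalRing (Module.End R (M i))) →
          (∀ P : ℕ → EndoStructure.PointedMatrix.{u, max u v} R,
            EndoStructure.PointedMatrix.IsDescendingChain.{u, v} P →
              EndoStructure.PointedMatrix.UniformlyStationaryOnAlmostAll.{u, v, w} P M) →
          EndoStructure.IsRightSemiTNilpotent R M)) ∧
    (∀ (X : Type v) [AddCommGroup X] [Module R X],
      EndoStructure.IsSigmaAlgebraicallyCompact R X →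
        ∃ (ι : Type v) (_ : DecidableEq ι) (N : ι → Submodule R X),
          DirectSum.IsInternal N ∧ (∀ i, EndoStructure.IsIndecomposable R (N i)) ∧
            EndoStructure.IsRightTNilpotent R (fun i => N i)) := by
  refine ⟨fun M _ _ hM => ⟨fun h i => ?_, fun hloc => ?_, fun hloc h => ?_⟩, fun X _ _ hX => ?_⟩
  · have := (hM i).1
    exact h.isLocalRing i
  · exact EndoStructure.tfae_isRightTNilpotent hM hloc
  · exact EndoStructure.isRightSemiTNilpotent_of_uniformlyStationary hM hloc h
  · exact hX.homValuesDCC.exists_isInternal
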